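/- Let $N\ge 0$ be an integer and let $\Gamma\in\mathbb{C}^{N\times N}$ be a unitary matrix with $\Gamma^2=I$ whose eigenspaces for $+1$ and $-1$ have the same dimension (so $N$ is even). Let $T>0$ and let $t\mapsto H(t)\in\mathbb{C}^{N\times N}$, $t\in\mathbb{R}$, be a locally integrable, $T$-periodic family of Hermitian matrices with the chiral symmetry $$\Gamma H(t)\Gamma=-H(-t)\qquad\text{for all } t\in\mathbb{R}.$$ Let $U(t)$ be the time evolution generated by $H(t)$, i.e. the continuous solution of $U(t)=I-i\int_0^t H(s)U(s)\,ds$ (the Schrödinger equation $iU'(t)=H(t)U(t)$, $U(0)=I$), and let $U(T)$ be the Floquet operator. Then there is a Hermitian matrix $H$ with $$\Gamma H=-H\Gamma\qquad\text{and}\qquad e^{-iH}=U(T).$$ Moreover, there are an orthonormal basis $b_1,\dots,b_N$ of $\mathbb{C}^N$, complex scalars $\lambda_1,\dots,\lambda_N$ of modulus one and real numbers $\mu_1,\dots,\mu_N$ such that, for $j=1,\dots,N$, $$U(T)b_j=\lambda_j b_j,\qquad Hb_j=\mu_j b_j,\qquad \lambda_j=e^{-i\mu_j},$$ and, for $j=1,\dots,N/2$,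 $$\Gamma b_j=b_{\frac N2+j},\qquad \overline{\lambda_j}=\lambda_{\frac N2+j},\qquad \mu_{\frac N2+j}=-\mu_j .$$ -/

import Mathlib

/-- The family `U t = U(0,t)` is the time evolution (propagator) generated by the time-dependent
Hamiltonian `H`, i.e. the solution of the Schrödinger equation `i U'(t) = H(t) U(t)`, `U(0) = 1`,
in integrated form: `U` is continuous and `U(t) = 1 - i ∫₀ᵗ H(s) U(s) ds` for every real `t`
(the integral of a matrix-valued function being taken entrywise). For locally integrable `H`
there is exactly one such `U`; for continuous `H` it is the classical solution. -/
def IsTimeEvolution {N : ℕ} (H U : ℝ → Matrix (Fin N) (Fin N) ℂ) : Prop :=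
  Continuous U ∧
    ∀ (t : ℝ) (j k : Fin N),
      U t j k = (1 : Matrix (Fin N) (Fin N) ℂ) j k
        - Complex.I * ∫ s in (0 : ℝ)..t, (H s * U s) j k

/-!
Reflecting time shows that `t ↦ Γ * U (-t) * Γ` solves the same Schrödinger equation as `U`, so the
two agree; combined with periodicity this gives `U T = Γ * (Fᴴ * Γ * F)` with `F = U (T / 2)`. The
Floquet operator is thus a product `A * B` of two self-adjoint involutions of trace zero.

Two such involutions split the space into orthogonal invariant planes `span {v, A v}` with `v ⟂ A v`
and `B v = exp (-iμ) • A v`. If `A` and `B` do not commute, take for `v` a common eigenvector of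
`A * B` and of the self-adjoint operator `i(AB - BA)`, at a nonzero eigenvalue of the latter. If
they commute, take `v = p + q` with `p`, `q` of the same norm, `A p = p`, `A q = -q` and
`B p = σ • p`, `B q = -σ • q` for a sign `σ`, which exist because the traces vanish.

On such a plane `A * B` has eigenvalue `exp (-iμ)` at `v` and `exp (iμ)` at `A v`. Choosing the
logarithms `μ` and `-μ` makes the effective Hamiltonian anticommute with `A`, also when these
eigenvalues coincide, as they do at `±1`.
-/

section AbsolutelyContinuous

open MeasureTheory Filter AbsolutelyContinuousOnInterval

theorem absolutelyContinuousOnInterval_const {X : Type*} [PseudoMetricSpace X] (c : X) (a b : ℝ) :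
    AbsolutelyContinuousOnInterval (fun _ ↦ c) a b := by
  simpa [AbsolutelyContinuousOnInterval] using tendsto_const_nhds

theorem absolutelyContinuousOnInterval_star {E : Type*} [SeminormedAddCommGroup E]
    [StarAddMonoid E] [NormedStarGroup E] {f : ℝ → E} {a b : ℝ}
    (hf : AbsolutelyContinuousOnInterval f a b) :
    AbsolutelyContinuousOnInterval (fun x ↦ star (f x)) a b := by
  simpa only [AbsolutelyContinuousOnInterval, dist_star_star] using hf

theorem absolutelyContinuousOnInterval_mul {R : Type*} [SeminormedRing R] {f g : ℝ → R} {a b : ℝ}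
    (hf : AbsolutelyContinuousOnInterval f a b) (hg : AbsolutelyContinuousOnInterval g a b) :
    AbsolutelyContinuousOnInterval (fun x ↦ f x * g x) a b := by
  obtain ⟨C, hC⟩ := hf.exists_bound
  obtain ⟨D, hD⟩ := hg.exists_bound
  have hsum : Tendsto (fun E : ℕ × (ℕ → ℝ × ℝ) ↦
      C * ∑ i ∈ Finset.range E.1, dist (g (E.2 i).1) (g (E.2 i).2) +
        (∑ i ∈ Finset.range E.1, dist (f (E.2 i).1) (f (E.2 i).2)) * D)
      (totalLengthFilter ⊓ 𝓟 (disjWithin a b)) (nhds 0) := by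
    simpa using (Tendsto.const_mul C hg).add (Tendsto.mul_const D hf)
  refine squeeze_zero' (.of_forall fun E ↦ Finset.sum_nonneg fun i _ ↦ dist_nonneg) ?_ hsum
  rw [eventually_inf_principal]
  refine .of_forall fun E hE ↦ ?_
  rw [Finset.mul_sum, Finset.sum_mul, ← Finset.sum_add_distrib]
  refine Finset.sum_le_sum fun i hi ↦ ?_
  obtain ⟨hx, hy⟩ := hE.1 i hi
  simp only [dist_eq_norm]
  calc ‖f (E.2 i).1 * g (E.2 i).1 - f (E.2 i).2 * g (E.2 i).2‖
      = ‖f (E.2 i).1 * (g (E.2 i).1 - g (E.2 i).2) +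
          (f (E.2 i).1 - f (E.2 i).2) * g (E.2 i).2‖ := by congr 1; noncomm_ring
    _ ≤ ‖f (E.2 i).1‖ * ‖g (E.2 i).1 - g (E.2 i).2‖ +
          ‖f (E.2 i).1 - f (E.2 i).2‖ * ‖g (E.2 i).2‖ :=
        norm_add_le_of_le (norm_mul_le _ _) (norm_mul_le _ _)
    _ ≤ C * ‖g (E.2 i).1 - g (E.2 i).2‖ + ‖f (E.2 i).1 - f (E.2 i).2‖ * D := by
        gcongr
        exacts [hC _ hx, hD _ hy]

variable {E : Type*} [NormedAddCommGroup E]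

theorem intervalIntegrable_of_locallyIntegrable {f : ℝ → E} (hf : LocallyIntegrable f) (a b : ℝ) :
    IntervalIntegrable f volume a b :=
  (hf.integrableOn_isCompact isCompact_uIcc).intervalIntegrable

theorem absolutelyContinuousOnInterval_integral [NormedSpace ℝ E] {f : ℝ → E}
    (hf : LocallyIntegrable f) (c a b : ℝ) :
    AbsolutelyContinuousOnInterval (fun x ↦ ∫ s in c..x, f s) a b := by
  have hfi := intervalIntegrable_of_locallyIntegrable hf
  have hnorm : AbsolutelyContinuousOnInterval (fun x ↦ ∫ s in a..x, ‖f s‖) a b :=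
    (hfi a b).norm.absolutelyContinuousOnInterval_intervalIntegral (by simp)
  refine squeeze_zero (fun E ↦ Finset.sum_nonneg fun i _ ↦ dist_nonneg)
    (fun E ↦ Finset.sum_le_sum fun i _ ↦ ?_) hnorm
  rw [dist_eq_norm, Real.dist_eq,
    intervalIntegral.integral_interval_sub_left (hfi _ _) (hfi _ _),
    intervalIntegral.integral_interval_sub_left (hfi _ _).norm (hfi _ _).norm]
  exact intervalIntegral.norm_integral_le_abs_integral_norm

end AbsolutelyContinuous

section LinearEvolution

open MeasureTheory

/-- `X` solves the linear equation `X'(t) = A(t) X(t)`, `X(0) = X₀` in a Banach algebra, in the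
integrated (Carathéodory) form which makes sense for a locally integrable coefficient `A`. -/
structure IsLinearEvolution {𝔸 : Type*} [NormedRing 𝔸] [NormedAlgebra ℝ 𝔸] (A : ℝ → 𝔸) (X₀ : 𝔸)
    (X : ℝ → 𝔸) : Prop where
  continuous : Continuous X
  eq_add_integral : ∀ t, X t = X₀ + ∫ s in (0 : ℝ)..t, A s * X s

namespace IsLinearEvolution

variable {𝔸 : Type*} [NormedRing 𝔸] [NormedAlgebra ℝ 𝔸] {A X Y : ℝ → 𝔸} {X₀ Y₀ : 𝔸}

theorem apply_zero (hX : IsLinearEvolution A X₀ X) : X 0 = X₀ := by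
  simpa using hX.eq_add_integral 0

theorem intervalIntegrable (hX : IsLinearEvolution A X₀ X) (hA : LocallyIntegrable A) (a b : ℝ) :
    IntervalIntegrable (fun s ↦ A s * X s) volume a b :=
  intervalIntegrable_of_locallyIntegrable (hA.mul_continuous hX.continuous) a b

theorem absolutelyContinuousOnInterval (hX : IsLinearEvolution A X₀ X)
    (hA : LocallyIntegrable A) (a b : ℝ) : AbsolutelyContinuousOnInterval X a b := by
  rw [funext hX.eq_add_integral]
  exact (absolutelyContinuousOnInterval_const X₀ a b).fun_add
    (absolutelyContinuousOnInterval_integral (hA.mul_continuous hX.continuous) 0 a b)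

theorem comp_neg (hX : IsLinearEvolution A X₀ X) :
    IsLinearEvolution (fun t ↦ -A (-t)) X₀ (fun t ↦ X (-t)) where
  continuous := hX.continuous.comp continuous_neg
  eq_add_integral t := by
    have hsubst := intervalIntegral.integral_comp_neg (a := 0) (b := t) (fun s ↦ A s * X s)
    simp only [neg_mul, intervalIntegral.integral_neg, hsubst]
    rw [neg_zero, ← intervalIntegral.integral_symm, ← hX.eq_add_integral]

theorem comp_add_right (hX : IsLinearEvolution A X₀ X) (hA : LocallyIntegrable A) (c : ℝ) :
    IsLinearEvolution (fun t ↦ A (t + c)) (X c) (fun t ↦ X (t + c)) where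
  continuous := hX.continuous.comp (continuous_add_const c)
  eq_add_integral t := by
    have hint := hX.intervalIntegrable hA
    rw [intervalIntegral.integral_comp_add_right (fun s ↦ A s * X s), zero_add,
      hX.eq_add_integral (t + c), hX.eq_add_integral c, add_assoc,
      intervalIntegral.integral_add_adjacent_intervals (hint 0 c) (hint c (t + c))]

variable [CompleteSpace 𝔸]

theorem conj (hX : IsLinearEvolution A X₀ X) (hA : LocallyIntegrable A) {a b : 𝔸}
    (hba : b * a = 1) :
    IsLinearEvolution (fun t ↦ a * A t * b) (a * X₀ * b) (fun t ↦ a * X t * b) where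
  continuous := (continuous_const.mul hX.continuous).mul continuous_const
  eq_add_integral t := by
    have hcancel (s : ℝ) : a * A s * b * (a * X s * b) = a * (A s * X s) * b := by
      simp only [mul_assoc]
      rw [← mul_assoc b a, hba, one_mul]
    have hint := (ContinuousLinearMap.mulLeftRight ℝ 𝔸 a b).intervalIntegral_comp_comm
      (hX.intervalIntegrable hA 0 t)
    simp only [ContinuousLinearMap.mulLeftRight_apply] at hint
    simp only [hcancel, hint, ← add_mul, ← mul_add, ← hX.eq_add_integral]

theorem ae_hasDerivAt (hX : IsLinearEvolution A X₀ X) (hA : LocallyIntegrable A) :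
    ∀ᵐ t, HasDerivAt X (A t * X t) t := by
  filter_upwards
    [LocallyIntegrable.ae_hasDerivAt_integral (hA.mul_continuous hX.continuous)] with t ht
  rw [funext hX.eq_add_integral]
  simpa only [← hX.eq_add_integral] using (ht 0).const_add X₀

section Star

variable [StarRing 𝔸] [StarModule ℝ 𝔸]

theorem star_mul_eq [NormedStarGroup 𝔸] (hX : IsLinearEvolution A X₀ X)
    (hY : IsLinearEvolution A Y₀ Y) (hA : LocallyIntegrable A) (hskew : ∀ t, A t ∈ skewAdjoint 𝔸)
    (t : ℝ) : star (X t) * Y t = star X₀ * Y₀ := by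
  have hac : AbsolutelyContinuousOnInterval (fun s ↦ star (X s) * Y s) 0 t :=
    absolutelyContinuousOnInterval_mul
      (absolutelyContinuousOnInterval_star (hX.absolutelyContinuousOnInterval hA 0 t))
      (hY.absolutelyContinuousOnInterval hA 0 t)
  have hderiv : ∀ᵐ s, HasDerivAt (fun s ↦ star (X s) * Y s) 0 s := by
    filter_upwards [hX.ae_hasDerivAt hA, hY.ae_hasDerivAt hA] with s hXs hYs
    refine (hXs.star.mul hYs).congr_deriv ?_
    rw [star_mul, skewAdjoint.mem_iff.mp (hskew s)]
    noncomm_ring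
  obtain ⟨C, hC⟩ := hac.const_of_ae_hasDerivAt_zero (hderiv.mono fun s hs _ ↦ hs)
  rw [hC t Set.right_mem_uIcc, ← hC 0 Set.left_mem_uIcc, hX.apply_zero, hY.apply_zero]

variable [CStarRing 𝔸]

theorem unique (hX : IsLinearEvolution A X₀ X) (hY : IsLinearEvolution A X₀ Y)
    (hA : LocallyIntegrable A) (hskew : ∀ t, A t ∈ skewAdjoint 𝔸) (t : ℝ) : X t = Y t := by
  rw [← sub_eq_zero, ← CStarRing.star_mul_self_eq_zero_iff, star_sub, sub_mul, mul_sub, mul_sub,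
    hX.star_mul_eq hX hA hskew, hX.star_mul_eq hY hA hskew, hY.star_mul_eq hX hA hskew,
    hY.star_mul_eq hY hA hskew]
  simp only [sub_self]

theorem conj_apply_neg_eq_of_chiral (hX : IsLinearEvolution A 1 X) (hA : LocallyIntegrable A)
    (hskew : ∀ t, A t ∈ skewAdjoint 𝔸) {g : 𝔸} (hg : g * g = 1)
    (hchiral : ∀ t, g * A t * g = -A (-t)) (t : ℝ) : g * X (-t) * g = X t := by
  have hreflect : IsLinearEvolution A 1 fun t ↦ g * X (-t) * g := by
    simpa [hchiral, hg] using (hX.conj hA hg).comp_neg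
  exact hreflect.unique hX hA hskew t

theorem floquet_eq (hX : IsLinearEvolution A 1 X) (hA : LocallyIntegrable A)
    (hskew : ∀ t, A t ∈ skewAdjoint 𝔸) {g : 𝔸} (hg : g * g = 1)
    (hchiral : ∀ t, g * A t * g = -A (-t)) {T : ℝ} (hper : Function.Periodic A T) :
    X T = g * (star (X (T / 2)) * g * X (T / 2)) := by
  have hshift : IsLinearEvolution A (X (-T)) fun t ↦ X (t + -T) := by
    simpa only [hper.neg _] using hX.comp_add_right hA (-T)
  have hhalf : star (X (T / 2)) * X (-(T / 2)) = X (-T) := by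
    simpa [show T / 2 + -T = -(T / 2) by ring] using hX.star_mul_eq hshift hA hskew (T / 2)
  have hreflect := hX.conj_apply_neg_eq_of_chiral hA hskew hg hchiral
  calc X T = g * (star (X (T / 2)) * (g * X (T / 2) * g)) * g := by
        rw [← hreflect T, ← hhalf, ← hreflect (-(T / 2)), neg_neg]
    _ = g * (star (X (T / 2)) * g * X (T / 2)) := by
        simp only [mul_assoc, hg, mul_one]

end Star

end IsLinearEvolution

end LinearEvolution

section MatrixEvolution

open MeasureTheory
open scoped Matrix.Norms.L2Operator

variable {N : ℕ} {H U : ℝ → Matrix (Fin N) (Fin N) ℂ}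

theorem locallyIntegrable_matrix_of_entries {m n : Type*} [Fintype m] [Fintype n] [DecidableEq n]
    {F : ℝ → Matrix m n ℂ} (hF : ∀ i j, LocallyIntegrable fun t ↦ F t i j) :
    LocallyIntegrable F := by
  classical
  have hsum : F = fun t ↦ ∑ i, ∑ j, F t i j • Matrix.single i j 1 := by
    funext t
    simpa [Matrix.smul_single] using Matrix.matrix_eq_sum_single (F t)
  rw [hsum]
  exact locallyIntegrable_finsetSum _ fun i _ ↦ locallyIntegrable_finsetSum _ fun j _ ↦
    LocallyIntegrable.smul_continuous continuous_const (hF i j)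

theorem neg_I_smul_mem_skewAdjoint {E : Type*} [AddCommGroup E] [Module ℂ E] [StarAddMonoid E]
    [StarModule ℂ E] {a : E} (ha : IsSelfAdjoint a) : -Complex.I • a ∈ skewAdjoint E :=
  ha.smul_mem_skewAdjoint (by simp [skewAdjoint.mem_iff])

namespace IsTimeEvolution

theorem isLinearEvolution (hU : IsTimeEvolution H U)
    (hH : ∀ j k, LocallyIntegrable fun t ↦ H t j k) :
    IsLinearEvolution (fun t ↦ -Complex.I • H t) 1 U where
  continuous := hU.1
  eq_add_integral t := by
    have hint := intervalIntegrable_of_locallyIntegrable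
      ((locallyIntegrable_matrix_of_entries hH).mul_continuous hU.1) 0 t
    ext j k
    have hentry := (Matrix.entryLinearMap ℝ ℂ j k).toContinuousLinearMap.intervalIntegral_comp_comm
      hint
    simp only [LinearMap.coe_toContinuousLinearMap', Matrix.entryLinearMap_apply] at hentry
    simp only [smul_mul_assoc, intervalIntegral.integral_smul, Matrix.add_apply, Matrix.smul_apply,
      smul_eq_mul, ← hentry, hU.2 t j k]
    ring

theorem conjTranspose_mul_self (hU : IsTimeEvolution H U)
    (hH : ∀ j k, LocallyIntegrable fun t ↦ H t j k) (hherm : ∀ t, (H t).IsHermitian) (t : ℝ) :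
    (U t).conjTranspose * U t = 1 := by
  have hX := hU.isLinearEvolution hH
  simpa [Matrix.star_eq_conjTranspose] using hX.star_mul_eq hX
    ((locallyIntegrable_matrix_of_entries hH).smul (-Complex.I))
    (fun t ↦ neg_I_smul_mem_skewAdjoint (hherm t)) t

theorem floquet_eq (hU : IsTimeEvolution H U) (hH : ∀ j k, LocallyIntegrable fun t ↦ H t j k)
    (hherm : ∀ t, (H t).IsHermitian) {Γ : Matrix (Fin N) (Fin N) ℂ} (hΓ : Γ * Γ = 1)
    (hchiral : ∀ t, Γ * H t * Γ = -H (-t)) {T : ℝ} (hper : Function.Periodic H T) :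
    U T = Γ * ((U (T / 2)).conjTranspose * Γ * U (T / 2)) :=
  (hU.isLinearEvolution hH).floquet_eq ((locallyIntegrable_matrix_of_entries hH).smul (-Complex.I))
    (fun t ↦ neg_I_smul_mem_skewAdjoint (hherm t)) hΓ
    (fun t ↦ by simp only [mul_smul_comm, smul_mul_assoc, hchiral, smul_neg])
    (fun t ↦ congrArg (-Complex.I • ·) (hper t))

end IsTimeEvolution

end MatrixEvolution

section OrthonormalExtension

open Module LinearMap Submodule
open scoped InnerProductSpace

variable {𝕜 V κ ι : Type*} [RCLike 𝕜] [NormedAddCommGroup V] [InnerProductSpace 𝕜 V] {f : κ → V}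

theorem orthonormal_sumElim {g : ι → V} (hf : Orthonormal 𝕜 f) (hg : Orthonormal 𝕜 g)
    (hfg : ∀ i j, ⟪f i, g j⟫_𝕜 = 0) : Orthonormal 𝕜 (Sum.elim f g) := by
  refine ⟨Sum.rec hf.1 hg.1, ?_⟩
  rintro (i | i) (j | j) hij
  · exact hf.2 (ne_of_apply_ne Sum.inl hij)
  · exact hfg i j
  · exact inner_eq_zero_symm.mp (hfg j i)
  · exact hg.2 (ne_of_apply_ne Sum.inr hij)

theorem orthonormal_pair {v w : V} (hv : ‖v‖ = 1) (hw : ‖w‖ = 1) (hvw : ⟪v, w⟫_𝕜 = 0) :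
    Orthonormal 𝕜 (Sum.elim (fun _ : Unit ↦ v) fun _ : Unit ↦ w) :=
  orthonormal_sumElim (orthonormal_subsingleton_iff.mpr fun _ ↦ hv)
    (orthonormal_subsingleton_iff.mpr fun _ ↦ hw) fun _ _ ↦ hvw

variable [Fintype κ] [Fintype ι]

/-- The orthonormal basis of `V` consisting of an orthonormal family followed by an orthonormal
basis of the orthogonal complement of its span. -/
noncomputable def orthonormalBasisExtend (hf : Orthonormal 𝕜 f)
    (c : OrthonormalBasis ι 𝕜 (span 𝕜 (Set.range f))ᗮ) : OrthonormalBasis (κ ⊕ ι) 𝕜 V :=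
  OrthonormalBasis.mk
    (orthonormal_sumElim hf (c.orthonormal.comp_linearIsometry (span 𝕜 (Set.range f))ᗮ.subtypeₗᵢ)
      fun i j ↦ inner_right_of_mem_orthogonal (subset_span (Set.mem_range_self i)) (c j).2)
    (by
      have : FiniteDimensional 𝕜 (span 𝕜 (Set.range f)) :=
        FiniteDimensional.span_of_finite 𝕜 (Set.finite_range f)
      have hc : span 𝕜 (Set.range fun j ↦ (c j : V)) = (span 𝕜 (Set.range f))ᗮ := by
        rw [Set.range_comp' Subtype.val c, ← coe_subtype, span_image, ← c.coe_toBasis,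
          c.toBasis.span_eq, map_subtype_top]
      rw [Set.Sum.elim_range, span_union]
      exact (sup_orthogonal_of_hasOrthogonalProjection (K := span 𝕜 (Set.range f))).ge.trans
        (sup_le_sup_left hc.ge _))

@[simp]
theorem coe_orthonormalBasisExtend (hf : Orthonormal 𝕜 f)
    (c : OrthonormalBasis ι 𝕜 (span 𝕜 (Set.range f))ᗮ) :
    ⇑(orthonormalBasisExtend hf c) = Sum.elim f fun j ↦ (c j : V) :=
  OrthonormalBasis.coe_mk _ _

theorem trace_eq_sum_inner_add_trace_restrict [FiniteDimensional 𝕜 V] (hf : Orthonormal 𝕜 f)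
    {A : V →ₗ[𝕜] V} (hA : ∀ x ∈ (span 𝕜 (Set.range f))ᗮ, A x ∈ (span 𝕜 (Set.range f))ᗮ) :
    trace 𝕜 V A = ∑ i, ⟪f i, A (f i)⟫_𝕜 + trace 𝕜 _ (A.restrict hA) := by
  let c := stdOrthonormalBasis 𝕜 (span 𝕜 (Set.range f))ᗮ
  rw [trace_eq_sum_inner A (orthonormalBasisExtend hf c), trace_eq_sum_inner _ c,
    Fintype.sum_sum_type]
  simp

end OrthonormalExtension

section BalancedInvolution

open Module LinearMap Submodule
open scoped InnerProductSpace

section EigenspaceTrace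

variable {K M : Type*} [Field K] [NeZero (2 : K)] [AddCommGroup M] [Module K M]
  {A : Module.End K M}

theorem isProj_eigenspace_of_mul_self_eq_one (hA : A * A = 1) {ε : K} (hε : ε * ε = 1) :
    IsProj (Module.End.eigenspace A ε) ((2⁻¹ : K) • (1 + ε • A)) where
  map_mem x := by
    have hAA : A (A x) = x := LinearMap.congr_fun hA x
    rw [Module.End.mem_eigenspace_iff]
    simp only [LinearMap.smul_apply, LinearMap.add_apply, Module.End.one_apply, map_smul, map_add,
      hAA]
    rw [smul_comm ε, smul_add ε, smul_smul ε ε, hε, one_smul, add_comm]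
  map_id x hx := by
    rw [Module.End.mem_eigenspace_iff] at hx
    simp only [LinearMap.smul_apply, LinearMap.add_apply, Module.End.one_apply]
    rw [hx, smul_smul, hε, one_smul, ← two_smul K x, smul_smul, inv_mul_cancel₀ two_ne_zero,
      one_smul]

theorem trace_eq_finrank_eigenspace_sub [FiniteDimensional K M] (hA : A * A = 1) :
    trace K M A = finrank K (Module.End.eigenspace A 1) -
      finrank K (Module.End.eigenspace A (-1)) := by
  have hpos := (isProj_eigenspace_of_mul_self_eq_one hA (mul_one 1)).trace
  have hneg := (isProj_eigenspace_of_mul_self_eq_one hA (ε := -1) (by simp)).trace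
  simp only [map_smul, map_add, smul_eq_mul] at hpos hneg
  have h2 : (2 : K) ≠ 0 := two_ne_zero
  rw [← hpos, ← hneg]
  field_simp
  ring

end EigenspaceTrace

/-- Self-adjoint involutions, i.e. the orthogonal reflections of an inner product space. -/
structure IsSelfAdjointInvolution {𝕜 V : Type*} [RCLike 𝕜] [NormedAddCommGroup V]
    [InnerProductSpace 𝕜 V] (A : Module.End 𝕜 V) : Prop where
  isSymmetric : A.IsSymmetric
  mul_self : A * A = 1

/-- Self-adjoint involutions whose eigenspaces for `1` and `-1` have equal dimension. The balance
is encoded by the trace, which is the difference of the two dimensions. -/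
structure IsBalancedInvolution {𝕜 V : Type*} [RCLike 𝕜] [NormedAddCommGroup V]
    [InnerProductSpace 𝕜 V] (A : Module.End 𝕜 V) : Prop extends IsSelfAdjointInvolution A where
  trace_eq_zero : trace 𝕜 V A = 0

variable {𝕜 V : Type*} [RCLike 𝕜] [NormedAddCommGroup V] [InnerProductSpace 𝕜 V]

namespace IsSelfAdjointInvolution

variable {A : Module.End 𝕜 V}

theorem apply_apply (hA : IsSelfAdjointInvolution A) (x : V) : A (A x) = x :=
  LinearMap.congr_fun hA.mul_self x

theorem norm_map (hA : IsSelfAdjointInvolution A) (x : V) : ‖A x‖ = ‖x‖ := by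
  rw [norm_eq_sqrt_re_inner (𝕜 := 𝕜), norm_eq_sqrt_re_inner (𝕜 := 𝕜), ← hA.isSymmetric,
    hA.apply_apply]

end IsSelfAdjointInvolution

namespace IsBalancedInvolution

variable [FiniteDimensional 𝕜 V] {A : Module.End 𝕜 V}

theorem adjoint_conj (hA : IsBalancedInvolution A) {F : Module.End 𝕜 V} (hF : F * adjoint F = 1) :
    IsBalancedInvolution (adjoint F * A * F) where
  isSymmetric x y := by
    simp only [Module.End.mul_apply, adjoint_inner_left, adjoint_inner_right,
      hA.isSymmetric (F x) (F y)]
  mul_self := by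
    calc adjoint F * A * F * (adjoint F * A * F) = adjoint F * (A * (F * adjoint F) * A) * F := by
          noncomm_ring
      _ = 1 := by rw [hF, mul_one, hA.mul_self, mul_one, mul_eq_one_comm.mp hF]
  trace_eq_zero := by rw [trace_mul_cycle, hF, one_mul, hA.trace_eq_zero]

theorem restrict_orthogonal (hA : IsBalancedInvolution A) {κ : Type*} [Finite κ] {f : κ → V}
    (hf : Orthonormal 𝕜 f) (hmem : ∀ i, A (f i) ∈ span 𝕜 (Set.range f))
    (hdiag : ∀ i, ⟪f i, A (f i)⟫_𝕜 = 0) :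
    ∃ hinv : ∀ x ∈ (span 𝕜 (Set.range f))ᗮ, A x ∈ (span 𝕜 (Set.range f))ᗮ,
      IsBalancedInvolution (A.restrict hinv) := by
  have hinv : ∀ x ∈ (span 𝕜 (Set.range f))ᗮ, A x ∈ (span 𝕜 (Set.range f))ᗮ :=
    hA.isSymmetric.orthogonalComplement_mem_invtSubmodule
      (span_le.mpr (Set.range_subset_iff.mpr hmem))
  refine ⟨hinv, ⟨hA.isSymmetric.restrict_invariant hinv,
    LinearMap.ext fun x ↦ Subtype.ext (hA.apply_apply x)⟩, ?_⟩
  have := Fintype.ofFinite κ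
  simpa [hA.trace_eq_zero, hdiag] using (trace_eq_sum_inner_add_trace_restrict hf hinv).symm

theorem restrict_orthogonal_pair (hA : IsBalancedInvolution A) {f : Unit ⊕ Unit → V}
    (hf : Orthonormal 𝕜 f) {l : 𝕜} (hl : A (f (.inl ())) = l • f (.inr ())) :
    ∃ hinv : ∀ x ∈ (span 𝕜 (Set.range f))ᗮ, A x ∈ (span 𝕜 (Set.range f))ᗮ,
      IsBalancedInvolution (A.restrict hinv) := by
  have hl0 : l ≠ 0 := by
    rintro rfl
    simpa [hl, hf.1] using hA.norm_map (f (.inl ()))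
  have hr : A (f (.inr ())) = l⁻¹ • f (.inl ()) := by
    rw [eq_inv_smul_iff₀ hl0, ← map_smul, ← hl, hA.apply_apply]
  refine hA.restrict_orthogonal hf ?_ ?_
  · rintro (_ | _)
    · exact hl ▸ smul_mem _ _ (subset_span (Set.mem_range_self _))
    · exact hr ▸ smul_mem _ _ (subset_span (Set.mem_range_self _))
  · rintro (_ | _)
    · rw [hl, inner_smul_right, hf.2 Sum.inl_ne_inr, mul_zero]
    · rw [hr, inner_smul_right, hf.2 Sum.inr_ne_inl, mul_zero]

end IsBalancedInvolution

theorem exists_hasEigenvalue_ne_zero_of_isSymmetric [FiniteDimensional 𝕜 V] {D : Module.End 𝕜 V}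
    (hD : D.IsSymmetric) (hD0 : D ≠ 0) : ∃ s : ℝ, s ≠ 0 ∧ D.HasEigenvalue (s : 𝕜) := by
  by_contra! hzero
  refine hD0 ((hD.eigenvectorBasis rfl).toBasis.ext fun i ↦ ?_)
  have hi : hD.eigenvalues rfl i = 0 := by
    by_contra hne
    exact hzero _ hne (hD.hasEigenvalue_eigenvalues rfl i)
  simp [hi]

theorem exists_common_eigenvector_of_commute {K M : Type*} [Field K] [IsAlgClosed K]
    [AddCommGroup M] [Module K M] [FiniteDimensional K M] {C D : Module.End K M}
    (hDC : Commute D C) {s : K} (hs : D.HasEigenvalue s) :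
    ∃ v ≠ 0, D v = s • v ∧ ∃ l : K, C v = l • v := by
  have hinv : Set.MapsTo C (Module.End.eigenspace D s) (Module.End.eigenspace D s) :=
    Module.End.mapsTo_genEigenspace_of_comm hDC s 1
  have : Nontrivial (Module.End.eigenspace D s) := nontrivial_iff_ne_bot.mpr hs
  obtain ⟨l, hl⟩ := Module.End.exists_eigenvalue (C.restrict hinv)
  obtain ⟨v, hv⟩ := hl.exists_hasEigenvector
  exact ⟨v, fun hv0 ↦ hv.2 (Subtype.ext hv0), Module.End.mem_eigenspace_iff.mp v.2, l,
    congrArg Subtype.val hv.apply_eq_smul⟩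

theorem inner_apply_eq_zero_of_anticommute {A D : Module.End 𝕜 V} (hD : D.IsSymmetric)
    (hAD : A * D = -(D * A)) {s : ℝ} (hs : s ≠ 0) {v : V} (hv : D v = (s : 𝕜) • v) :
    ⟪v, A v⟫_𝕜 = 0 := by
  have hADv : D (A v) = -A (D v) := by
    simpa using congrArg Neg.neg (LinearMap.congr_fun hAD v).symm
  have hsym := hD v (A v)
  rw [hADv, hv, map_smul, inner_neg_right, inner_smul_left, inner_smul_right,
    RCLike.conj_ofReal, eq_neg_iff_add_eq_zero, ← two_mul] at hsym
  simpa [hs] using hsym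

theorem exists_apply_eq_smul_of_commute {K M : Type*} [CommRing K] [AddCommGroup M] [Module K M]
    {A B : Module.End K M} (hA : A * A = 1) (hB : B * B = 1) (hAB : Commute A B) {ε δ : K}
    (hε : ε * ε = 1) (hδ : δ * δ = 1) (hne : (1 + ε • A) * (1 + δ • B) ≠ 0) :
    ∃ p ≠ 0, A p = ε • p ∧ B p = δ • p := by
  obtain ⟨x, hx⟩ : ∃ x, ((1 + ε • A) * (1 + δ • B)) x ≠ 0 := by
    by_contra! hzero
    exact hne (LinearMap.ext hzero)
  have eigenprojection {C : Module.End K M} (hC : C * C = 1) {η : K} (hη : η * η = 1) :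
      C * (1 + η • C) = η • (1 + η • C) := by
    rw [mul_add, mul_one, mul_smul_comm, hC, smul_add, smul_smul, hη, one_smul, add_comm]
  refine ⟨_, hx, ?_, ?_⟩
  · rw [← Module.End.mul_apply, ← mul_assoc, eigenprojection hA hε, smul_mul_assoc,
      LinearMap.smul_apply]
  · have hswap : Commute (1 + ε • A) (1 + δ • B) :=
      .add_left (.one_left _) (.add_right (.one_right _) ((hAB.smul_left ε).smul_right δ))
    rw [hswap.eq, ← Module.End.mul_apply, ← mul_assoc, eigenprojection hB hδ, smul_mul_assoc,
      LinearMap.smul_apply]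

section Complex

variable {V : Type*} [NormedAddCommGroup V] [InnerProductSpace ℂ V] [FiniteDimensional ℂ V]
  {A B : Module.End ℂ V}

theorem IsSelfAdjointInvolution.exists_apply_eq_smul_apply_of_not_commute
    (hA : IsSelfAdjointInvolution A) (hB : IsSelfAdjointInvolution B) (hAB : ¬Commute A B) :
    ∃ v ≠ 0, ⟪v, A v⟫_ℂ = 0 ∧ ∃ l : ℂ, B v = l • A v := by
  -- `D` commutes with `A * B` and anticommutes with `A`, so `A` maps its `s`-eigenspace to the
  -- `-s`-eigenspace, which is orthogonal to it when `s ≠ 0`.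
  set D : Module.End ℂ V := Complex.I • (A * B - B * A) with hD
  have hD_symm : D.IsSymmetric := fun x y ↦ by
    simp only [hD, LinearMap.smul_apply, LinearMap.sub_apply, Module.End.mul_apply,
      inner_smul_left, inner_smul_right, inner_sub_left, inner_sub_right, Complex.conj_I,
      hA.isSymmetric _ _, hB.isSymmetric _ _]
    ring
  have hD_ne : D ≠ 0 := smul_ne_zero Complex.I_ne_zero (sub_ne_zero.mpr hAB)
  have hAD : A * D = -(D * A) := by
    simp only [hD, mul_smul_comm, smul_mul_assoc, mul_sub, sub_mul, ← mul_assoc, hA.mul_self]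
    simp only [mul_assoc, hA.mul_self, one_mul, mul_one, ← smul_neg, neg_sub]
  have hinverse : Commute (A * B) (B * A) := by
    simp only [Commute, SemiconjBy, mul_assoc]
    simp only [← mul_assoc B, ← mul_assoc A A, hA.mul_self, hB.mul_self, one_mul]
  have hcomm : Commute D (A * B) := ((Commute.refl _).sub_left hinverse.symm).smul_left _
  obtain ⟨s, hs, hsD⟩ := exists_hasEigenvalue_ne_zero_of_isSymmetric hD_symm hD_ne
  obtain ⟨v, hv, hDv, l, hl⟩ := exists_common_eigenvector_of_commute hcomm hsD
  refine ⟨v, hv, inner_apply_eq_zero_of_anticommute hD_symm hAD hs hDv, l, ?_⟩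
  rw [← map_smul, ← hl, Module.End.mul_apply, hA.apply_apply]

namespace IsBalancedInvolution

theorem exists_apply_eq_smul_apply_of_commute [Nontrivial V] (hA : IsBalancedInvolution A)
    (hB : IsBalancedInvolution B) (hAB : Commute A B) :
    ∃ v ≠ 0, ⟪v, A v⟫_ℂ = 0 ∧ ∃ l : ℂ, B v = l • A v := by
  -- `trace ((1 + ε • A) * (1 + (σ * ε) • B)) = finrank ℂ V + σ * trace (A * B)` for both signs `ε`.
  obtain ⟨σ, hσ, hσ_trace⟩ : ∃ σ : ℂ, σ * σ = 1 ∧ finrank ℂ V + σ * trace ℂ V (A * B) ≠ 0 := by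
    by_contra! hzero
    have hpos := hzero 1 (by simp)
    have hneg := hzero (-1) (by simp)
    have hrank : (finrank ℂ V : ℂ) = 0 := by linear_combination (hpos + hneg) / 2
    exact Module.finrank_pos.ne' (Nat.cast_eq_zero.mp hrank)
  have joint_eigenvector (ε : ℂ) (hε : ε * ε = 1) :
      ∃ p ≠ 0, A p = ε • p ∧ B p = (σ * ε) • p := by
    refine exists_apply_eq_smul_of_commute hA.mul_self hB.mul_self hAB hε
      (by linear_combination ε ^ 2 * hσ + hε) fun hzero ↦ hσ_trace ?_
    have htrace := congrArg (trace ℂ V) hzero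
    simp only [mul_add, add_mul, one_mul, mul_one, smul_mul_smul_comm, map_add, map_smul,
      trace_one, hA.trace_eq_zero, hB.trace_eq_zero, map_zero, smul_eq_mul] at htrace
    linear_combination htrace - σ * trace ℂ V (A * B) * hε
  obtain ⟨p, hp, hAp, hBp⟩ := joint_eigenvector 1 (by simp)
  obtain ⟨q, hq, hAq, hBq⟩ := joint_eigenvector (-1) (by simp)
  have hpq : ⟪p, q⟫_ℂ = 0 := by
    have hsym := hA.isSymmetric p q
    rw [hAp, hAq, inner_smul_left, inner_smul_right, map_one] at hsym
    linear_combination hsym / 2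
  have hqp : ⟪q, p⟫_ℂ = 0 := inner_eq_zero_symm.mp hpq
  refine ⟨(‖q‖ : ℂ) • p + (‖p‖ : ℂ) • q, fun hzero ↦ ?_, ?_, σ, ?_⟩
  · have hinner := congrArg (⟪p, ·⟫_ℂ) hzero
    simp [hpq, hp, hq] at hinner
  · simp only [map_add, map_smul, hAp, hAq, inner_add_left, inner_add_right, inner_smul_left,
      inner_smul_right, hpq, hqp, Complex.conj_ofReal, inner_self_eq_norm_sq_to_K,
      Complex.coe_algebraMap]
    ring
  · simp only [map_add, map_smul, hAp, hAq, hBp, hBq]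
    module

theorem exists_apply_eq_exp_smul_apply [Nontrivial V] (hA : IsBalancedInvolution A)
    (hB : IsBalancedInvolution B) :
    ∃ v, ‖v‖ = 1 ∧ ⟪v, A v⟫_ℂ = 0 ∧ ∃ μ : ℝ, B v = Complex.exp (-Complex.I * μ) • A v := by
  obtain ⟨v, hv, hvA, l, hl⟩ : ∃ v ≠ 0, ⟪v, A v⟫_ℂ = 0 ∧ ∃ l : ℂ, B v = l • A v := by
    by_cases hAB : Commute A B
    · exact hA.exists_apply_eq_smul_apply_of_commute hB hAB
    · exact hA.exists_apply_eq_smul_apply_of_not_commute hB.toIsSelfAdjointInvolution hAB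
  have hl_norm : ‖l‖ = 1 := by
    have hnorm : ‖v‖ = ‖l‖ * ‖v‖ := by
      rw [← hA.norm_map v, ← norm_smul, ← hl, hB.norm_map, hA.norm_map]
    exact (right_eq_mul₀ (norm_ne_zero_iff.mpr hv)).mp hnorm
  obtain ⟨θ, rfl⟩ := (Complex.norm_eq_one_iff l).mp hl_norm
  refine ⟨(‖v‖ : ℂ)⁻¹ • v, norm_smul_inv_norm hv, ?_, -θ, ?_⟩
  · rw [map_smul, inner_smul_left, inner_smul_right, hvA, mul_zero, mul_zero]
  · rw [map_smul, map_smul, hl, smul_comm, Complex.ofReal_neg, neg_mul_neg, mul_comm Complex.I]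

theorem exists_orthonormalBasis_pair {V : Type*} [NormedAddCommGroup V] [InnerProductSpace ℂ V]
    [FiniteDimensional ℂ V] {A B : Module.End ℂ V} (hA : IsBalancedInvolution A)
    (hB : IsBalancedInvolution B) :
    ∃ (ι : Type) (_ : Fintype ι) (b : OrthonormalBasis (ι ⊕ ι) ℂ V) (μ : ι → ℝ), ∀ i,
      A (b (.inl i)) = b (.inr i) ∧
        B (b (.inl i)) = Complex.exp (-Complex.I * μ i) • b (.inr i) := by
  obtain _ | _ := subsingleton_or_nontrivial V
  · exact ⟨Empty, inferInstance, .mk (v := isEmptyElim) ⟨isEmptyElim, isEmptyElim⟩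
      (Subsingleton.elim _ _).le, Empty.elim, Empty.rec⟩
  obtain ⟨v, hv, hvA, μ₀, hμ₀⟩ := hA.exists_apply_eq_exp_smul_apply hB
  set f : Unit ⊕ Unit → V := Sum.elim (fun _ ↦ v) fun _ ↦ A v
  have hf : Orthonormal ℂ f := orthonormal_pair hv ((hA.norm_map v).trans hv) hvA
  obtain ⟨hAinv, hA'⟩ := hA.restrict_orthogonal_pair hf (one_smul ℂ (A v)).symm
  obtain ⟨hBinv, hB'⟩ := hB.restrict_orthogonal_pair hf hμ₀
  obtain ⟨ι, _, c, μ, hc⟩ := hA'.exists_orthonormalBasis_pair hB'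
  refine ⟨Unit ⊕ ι, inferInstance,
    (orthonormalBasisExtend hf c).reindex (Equiv.sumSumSumComm _ _ _ _),
    Sum.elim (fun _ ↦ μ₀) μ, ?_⟩
  rintro (_ | i)
  · exact ⟨by simp [f], by simpa [f] using hμ₀⟩
  · exact ⟨by simpa using congrArg Subtype.val (hc i).1,
      by simpa using congrArg Subtype.val (hc i).2⟩
termination_by finrank ℂ V
decreasing_by
  have hspan : span ℂ (Set.range f) ≠ ⊥ := (Submodule.ne_bot_iff _).mpr
    ⟨v, subset_span ⟨.inl (), rfl⟩, norm_ne_zero_iff.mp (hv ▸ one_ne_zero)⟩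
  have := finrank_add_finrank_orthogonal (span ℂ (Set.range f))
  have := one_le_finrank_iff.mpr hspan
  lia

theorem exists_orthonormalBasis_swap (hA : IsBalancedInvolution A) (hB : IsBalancedInvolution B) :
    ∃ (ι : Type) (_ : Fintype ι) (b : OrthonormalBasis (ι ⊕ ι) ℂ V) (μ : ι → ℝ),
      (∀ i, A (b i) = b i.swap) ∧
        ∀ i, A (B (b i)) = Complex.exp (-Complex.I * (Sum.elim μ (-μ) i : ℝ)) • b i := by
  obtain ⟨ι, _, b, μ, hb⟩ := hA.exists_orthonormalBasis_pair hB
  have hAr (i : ι) : A (b (.inr i)) = b (.inl i) := by rw [← (hb i).1, hA.apply_apply]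
  have hBr (i : ι) : B (b (.inr i)) = Complex.exp (Complex.I * μ i) • b (.inl i) := by
    rw [← hB.apply_apply (b (.inl i)), (hb i).2, map_smul, smul_smul, ← Complex.exp_add]
    simp
  refine ⟨ι, inferInstance, b, μ, ?_, ?_⟩
  · rintro (i | i)
    exacts [(hb i).1, hAr i]
  · rintro (i | i)
    · rw [(hb i).2, map_smul, hAr, Sum.elim_inl]
    · rw [hBr, map_smul, (hb i).1]
      simp

end IsBalancedInvolution

end Complex

end BalancedInvolution

section SpectralMatrix

open LinearMap Matrix
open scoped InnerProductSpace

theorem exp_apply_eq_smul {𝕜 E : Type*} [RCLike 𝕜] [NormedAddCommGroup E] [NormedSpace 𝕜 E]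
    [CompleteSpace E] {A : E →L[𝕜] E} {s : 𝕜} {v : E} (hv : A v = s • v) :
    NormedSpace.exp A v = NormedSpace.exp s • v := by
  have hpow (k : ℕ) : (A ^ k) v = s ^ k • v := by
    induction k with
    | zero => simp
    | succ k ih =>
      rw [pow_succ, mul_apply_eq_comp, hv, map_smul, ih, smul_smul, pow_succ']
  have hA := (NormedSpace.exp_series_hasSum_exp' (𝕂 := 𝕜) A).mapL (.apply 𝕜 E v)
  simp only [ContinuousLinearMap.apply_apply, _root_.smul_apply, hpow, smul_smul] at hA
  exact hA.unique ((NormedSpace.exp_series_hasSum_exp' (𝕂 := 𝕜) s).smul_const v)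

variable {𝕜 n ι : Type*} [RCLike 𝕜] [Fintype n] [DecidableEq n] [Fintype ι]

open scoped Matrix.Norms.L2Operator in
theorem toEuclideanLin_exp_apply_eq_smul {M : Matrix n n 𝕜} {s : 𝕜} {v : EuclideanSpace 𝕜 n}
    (hv : toEuclideanLin M v = s • v) :
    toEuclideanLin (NormedSpace.exp M) v = NormedSpace.exp s • v := by
  have : NormedAlgebra ℚ (Matrix n n 𝕜) := .restrictScalars ℚ 𝕜 _
  have hmap := NormedSpace.map_exp (toEuclideanCLM (n := n) (𝕜 := 𝕜))
    (AddMonoidHomClass.isometry_of_norm toEuclideanCLM l2_opNorm_toEuclideanCLM).continuous M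
  rw [← coe_toEuclideanCLM_eq_toEuclideanLin, hmap]
  exact exp_apply_eq_smul hv

theorem trace_toEuclideanLin (M : Matrix n n 𝕜) : trace 𝕜 _ (toEuclideanLin M) = M.trace := by
  rw [toEuclideanLin, toLpLin_eq_toLin, trace_toLin_eq]

variable (b : OrthonormalBasis ι 𝕜 (EuclideanSpace 𝕜 n))

theorem matrix_ext_orthonormalBasis {M M' : Matrix n n 𝕜}
    (h : ∀ i, toEuclideanLin M (b i) = toEuclideanLin M' (b i)) : M = M' :=
  toEuclideanLin.injective (b.toBasis.ext fun i ↦ by simpa using h i)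

/-- The Hermitian matrix with eigenvalue `μ i` on the `i`-th vector of an orthonormal basis. -/
noncomputable def spectralMatrix (μ : ι → ℝ) : Matrix n n 𝕜 :=
  toEuclideanLin.symm (b.toBasis.constr 𝕜 fun i ↦ (μ i : 𝕜) • b i)

variable (μ : ι → ℝ)

theorem toEuclideanLin_spectralMatrix_apply (i : ι) :
    toEuclideanLin (spectralMatrix b μ) (b i) = (μ i : 𝕜) • b i := by
  rw [spectralMatrix, LinearEquiv.apply_symm_apply]
  simpa using b.toBasis.constr_basis 𝕜 (fun i ↦ (μ i : 𝕜) • b i) i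

theorem isHermitian_spectralMatrix : (spectralMatrix b μ).IsHermitian := by
  classical
  rw [← isSymmetric_toEuclideanLin_iff, isSymmetric_iff_isSelfAdjoint, isSelfAdjoint_iff',
    eq_comm, eq_adjoint_iff_basis b.toBasis b.toBasis]
  intro i j
  simp only [OrthonormalBasis.coe_toBasis, toEuclideanLin_spectralMatrix_apply, inner_smul_left,
    inner_smul_right, RCLike.conj_ofReal, b.inner_eq_ite]
  split_ifs with hij
  · rw [hij]
  · simp

variable {b μ}

theorem mul_spectralMatrix_eq_neg {Γ : Matrix n n 𝕜} {σ : ι → ι}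
    (hΓ : ∀ i, toEuclideanLin Γ (b i) = b (σ i)) (hμ : ∀ i, μ (σ i) = -μ i) :
    Γ * spectralMatrix b μ = -(spectralMatrix b μ * Γ) := by
  refine matrix_ext_orthonormalBasis b fun i ↦ ?_
  simp [toLpLin_mul_same, toEuclideanLin_spectralMatrix_apply, hΓ, hμ]

theorem exp_smul_spectralMatrix {c : 𝕜} {M : Matrix n n 𝕜}
    (hM : ∀ i, toEuclideanLin M (b i) = NormedSpace.exp (c * μ i) • b i) :
    NormedSpace.exp (c • spectralMatrix b μ) = M := by
  refine matrix_ext_orthonormalBasis b fun i ↦ ?_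
  rw [hM i, toEuclideanLin_exp_apply_eq_smul]
  rw [map_smul, LinearMap.smul_apply, toEuclideanLin_spectralMatrix_apply, smul_smul]

end SpectralMatrix

section Floquet

open Matrix

theorem isHermitian_of_mem_unitaryGroup_of_mul_self {n R : Type*} [Fintype n] [DecidableEq n]
    [CommRing R] [StarRing R] {Γ : Matrix n n R} (hΓ : Γ ∈ unitaryGroup n R) (hsq : Γ * Γ = 1) :
    Γ.IsHermitian :=
  left_inv_eq_right_inv (mem_unitaryGroup_iff'.mp hΓ) hsq

theorem trace_eq_zero_of_finrank_eigenspace_eq {n K : Type*} [Fintype n] [DecidableEq n] [Field K]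
    [NeZero (2 : K)] {Γ : Matrix n n K} (hsq : Γ * Γ = 1)
    (hdim : Module.finrank K (Module.End.eigenspace (toLin' Γ) 1) =
      Module.finrank K (Module.End.eigenspace (toLin' Γ) (-1))) : Γ.trace = 0 := by
  have htoLin : toLin' Γ * toLin' Γ = 1 := by
    rw [Module.End.mul_eq_comp, ← toLin'_mul, hsq, toLin'_one, Module.End.one_eq_id]
  rw [← trace_toLin'_eq, trace_eq_finrank_eigenspace_sub htoLin, hdim, sub_self]

theorem isBalancedInvolution_toEuclideanLin {𝕜 n : Type*} [RCLike 𝕜] [Fintype n] [DecidableEq n]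
    {Γ : Matrix n n 𝕜} (hherm : Γ.IsHermitian) (hsq : Γ * Γ = 1) (htrace : Γ.trace = 0) :
    IsBalancedInvolution (toEuclideanLin Γ) where
  isSymmetric := isSymmetric_toEuclideanLin_iff.mpr hherm
  mul_self := by
    rw [Module.End.mul_eq_comp, ← toLpLin_mul_same, hsq, toLpLin_one, Module.End.one_eq_id]
  trace_eq_zero := (trace_toEuclideanLin Γ).trans htrace

theorem IsTimeEvolution.exists_orthonormalBasis_swap {N : ℕ}
    {H U : ℝ → Matrix (Fin N) (Fin N) ℂ} (hU : IsTimeEvolution H U)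
    (hH : ∀ j k, MeasureTheory.LocallyIntegrable fun t ↦ H t j k) (hherm : ∀ t, (H t).IsHermitian)
    {Γ : Matrix (Fin N) (Fin N) ℂ} (hΓ : IsBalancedInvolution (toEuclideanLin Γ))
    (hchiral : ∀ t, Γ * H t * Γ = -H (-t)) {T : ℝ} (hper : Function.Periodic H T) :
    ∃ (ι : Type) (_ : Fintype ι) (b : OrthonormalBasis (ι ⊕ ι) ℂ (EuclideanSpace ℂ (Fin N)))
      (μ : ι → ℝ), (∀ i, toEuclideanLin Γ (b i) = b i.swap) ∧
        ∀ i, toEuclideanLin (U T) (b i) =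
          Complex.exp (-Complex.I * (Sum.elim μ (-μ) i : ℝ)) • b i := by
  have hsq : Γ * Γ = 1 := toEuclideanLin.injective <| by
    rw [toLpLin_mul_same, toLpLin_one]
    exact hΓ.mul_self
  have hunitary :
      toEuclideanLin (U (T / 2)) * LinearMap.adjoint (toEuclideanLin (U (T / 2))) = 1 := by
    rw [← toEuclideanLin_conjTranspose_eq_adjoint, Module.End.mul_eq_comp, ← toLpLin_mul_same,
      mul_eq_one_comm.mp (hU.conjTranspose_mul_self hH hherm _), toLpLin_one, Module.End.one_eq_id]
  obtain ⟨ι, _, b, μ, hbΓ, hbU⟩ := hΓ.exists_orthonormalBasis_swap (hΓ.adjoint_conj hunitary)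
  refine ⟨ι, inferInstance, b, μ, hbΓ, fun i ↦ ?_⟩
  rw [← hbU i, hU.floquet_eq hH hherm hsq hchiral hper]
  simp only [toLpLin_mul_same, toEuclideanLin_conjTranspose_eq_adjoint, Module.End.mul_apply,
    LinearMap.comp_apply]

theorem exists_equiv_fin_card_sum_self (ι : Type*) [Fintype ι] {N : ℕ}
    (hN : Fintype.card (ι ⊕ ι) = N) :
    ∃ e : ι ⊕ ι ≃ Fin N, ∀ (j : ℕ) (hj : j < N / 2), ∃ i,
      e (.inl i) = ⟨j, by lia⟩ ∧ e (.inr i) = ⟨N / 2 + j, by lia⟩ := by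
  rw [Fintype.card_sum] at hN
  let e₀ := Fintype.equivFin ι
  refine ⟨(e₀.sumCongr e₀).trans (finSumFinEquiv.trans (finCongr hN)), fun j hj ↦
    ⟨e₀.symm ⟨j, by lia⟩, Fin.ext (by simp), Fin.ext (by simp; lia)⟩⟩

end Floquet

theorem mainTheorem2 (N : ℕ) (T : ℝ) (hT : 0 < T)
    (Γ : Matrix (Fin N) (Fin N) ℂ)
    (hΓ_unitary : Γ ∈ Matrix.unitaryGroup (Fin N) ℂ)
    (hΓ_sq : Γ * Γ = 1)
    (hΓ_balanced :
      Module.finrank ℂ (Module.End.eigenspace (Matrix.toLin' Γ) (1 : ℂ)) =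
        Module.finrank ℂ (Module.End.eigenspace (Matrix.toLin' Γ) (-1 : ℂ)))
    (H : ℝ → Matrix (Fin N) (Fin N) ℂ)
    (hH_int : ∀ j k : Fin N, MeasureTheory.LocallyIntegrable (fun t => H t j k))
    (hH_herm : ∀ t, (H t).IsHermitian)
    (hH_periodic : Function.Periodic H T)
    (hH_chiral : ∀ t, Γ * H t * Γ = -H (-t))
    (U : ℝ → Matrix (Fin N) (Fin N) ℂ)
    (hU : IsTimeEvolution H U) :
    ∃ H_F : Matrix (Fin N) (Fin N) ℂ,
      H_F.IsHermitian ∧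
      Γ * H_F = -(H_F * Γ) ∧
      NormedSpace.exp (-Complex.I • H_F) = U T ∧
      ∃ (b : OrthonormalBasis (Fin N) ℂ (EuclideanSpace ℂ (Fin N)))
        (lam : Fin N → ℂ) (μ : Fin N → ℝ),
        (∀ j, ‖lam j‖ = 1 ∧
          Matrix.toEuclideanLin (U T) (b j) = lam j • b j ∧
          Matrix.toEuclideanLin H_F (b j) = (μ j : ℂ) • b j ∧
          lam j = Complex.exp (-Complex.I * (μ j : ℂ))) ∧
        ∀ (j : ℕ) (hj : j < N / 2),
          Matrix.toEuclideanLin Γ (b ⟨j, by omega⟩) = b ⟨N / 2 + j, by omega⟩ ∧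
          (starRingEnd ℂ) (lam ⟨j, by omega⟩) = lam ⟨N / 2 + j, by omega⟩ ∧
          μ ⟨N / 2 + j, by omega⟩ = -μ ⟨j, by omega⟩ := by
  have hΓ : IsBalancedInvolution (Matrix.toEuclideanLin Γ) :=
    isBalancedInvolution_toEuclideanLin
      (isHermitian_of_mem_unitaryGroup_of_mul_self hΓ_unitary hΓ_sq) hΓ_sq
      (trace_eq_zero_of_finrank_eigenspace_eq hΓ_sq hΓ_balanced)
  obtain ⟨ι, _, b, θ, hbΓ, hbU⟩ :=
    hU.exists_orthonormalBasis_swap hH_int hH_herm hΓ hH_chiral hH_periodic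
  obtain ⟨e, he⟩ := exists_equiv_fin_card_sum_self ι
    ((Module.finrank_eq_card_basis b.toBasis).symm.trans finrank_euclideanSpace_fin)
  set ν : ι ⊕ ι → ℝ := Sum.elim θ (-θ)
  refine ⟨spectralMatrix b ν, isHermitian_spectralMatrix b ν,
    mul_spectralMatrix_eq_neg hbΓ (by simp [ν]),
    exp_smul_spectralMatrix fun i ↦ by rw [hbU i, Complex.exp_eq_exp_ℂ]; rfl,
    b.reindex e, fun j ↦ Complex.exp (-Complex.I * ν (e.symm j)), ν ∘ e.symm,
    fun j ↦ ⟨?_, ?_, ?_, rfl⟩, fun j hj ↦ ?_⟩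
  · simp [Complex.norm_exp]
  · simpa using hbU (e.symm j)
  · simpa using toEuclideanLin_spectralMatrix_apply b ν (e.symm j)
  · obtain ⟨i, hinl, hinr⟩ := he j hj
    refine ⟨?_, ?_, ?_⟩ <;> rw [← hinl, ← hinr]
    · simp [hbΓ]
    · simp [ν, ← Complex.exp_conj]
    · simp [ν]
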